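/- Let $\mathcal X$ be a separable Banach manifold of class $C^k$, $k\ge 1$ (or smooth, or analytic), modelled on a real Banach space $E$, and let $\mathcal H$ be a real Banach space. For each $q\in\mathcal X$ let $\langle\cdot,\cdot\rangle_q$ be an inner product on $\mathcal H$ whose norm is equivalent to the norm of $\mathcal H$, and suppose that $q\mapsto\langle\cdot,\cdot\rangle_q$ is Fréchet differentiable as a map into the bounded bilinear forms on $\mathcal H$. For each $q\in\mathcal X$ let $A(q)$ be a linear operator in $\mathcal H$ such that: (i) all the $A(q)$ have the same domain $\mathcal D$, a dense linear subspace of $\mathcal H$, and $A(q)$ is self-adjoint with respect to $\langle\cdot,\cdot\rangle_q$; (ii) the spectrum of each $A(q)$ consists of eigenvalues of finite multiplicity and has no finite accumulation point; (iii) the resolvents depend Fréchet-differentiably on $q$: if $\mu\in\mathbb R$ is in the resolvent set of $A(q_0)$, then $\mu$ is in the resolvent set of $A(q)$ for all $q$ near $q_0$, and $q\mapsto R_\mu(q)=(\mu-A(q))^{-1}$, as a map into the bounded operators on $\mathcal H$, is Fréchet differentiable at $q_0$; (iv) (condition SAH2) for every $q\in\mathcal X$ and every eigenvalue $\lambda$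 of $A(q)$ of multiplicity at least $2$ there are two eigenvectors $v_1,v_2$ of $A(q)$ with eigenvalue $\lambda$, orthonormal for $\langle\cdot,\cdot\rangle_q$, and a real number $\mu$ in the resolvent set of $A(q)$, such that the linear functionals $f'_{11}-f'_{22}$ and $f'_{12}$ on $T_q\mathcal X$ are linearly independent, where $f'_{ij}(h)=\langle R_\mu'(q)[h]\,v_i,v_j\rangle_q$. Then the set of all $q\in\mathcal X$ such that $A(q)$ has a repeated eigenvalue (an eigenvalue of multiplicity at least $2$) has meagre codimension $2$ in $\mathcal X$. Here a subset $Y$ of a Banach manifold $\mathcal X$ modelled on $E$ has meagre codimension $n\ge 1$ if for every chart $(\phi,U)$ of $\mathcal X$, every closed linear subspace $Z\subset E$ of codimension $n-1$ and every nonlinear projection $\pi:\phi(U)\to Z$, the set $\pi(\phi(U\cap Y))$ is meagre in $Z$; a nonlinear projection $\pi:\phi(U)\to Z$ is a Fréchet differentiable map such that, for all $x\in\phi(U)$, the derivative $\pi'_x:E\to Z$ is onto and $\dim\ker\pi'_x=n-1$. -/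

import Mathlib

open Set Filter Topology
open scoped Manifold ContDiff

noncomputable section

namespace MeagreCodim

section Codimension

variable {E : Type*} [NormedAddCommGroup E] [NormedSpace ℝ E]

/-- `π` is a nonlinear projection of codimension `n` from the open set `Ω` of the Banach space `E`
onto the closed linear subspace `Z` of `E`: the subspace `Z` has codimension `n`, and at every point
of `Ω` the map `π` is Fréchet differentiable, its derivative is onto, and the kernel of the
derivative has dimension `n`.  The values of `π` off `Ω` play no role. -/
structure IsNonlinearProjection (Ω : Set E) (Z : Submodule ℝ E) (n : ℕ) (π : E → Z) : Prop where
  isClosed : IsClosed (Z : Set E)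
  codim : Module.rank ℝ (E ⧸ Z) = n
  differentiableAt : ∀ x ∈ Ω, DifferentiableAt ℝ π x
  surjective : ∀ x ∈ Ω, Function.Surjective (fderiv ℝ π x)
  rank_ker : ∀ x ∈ Ω, Module.rank ℝ (LinearMap.ker (fderiv ℝ π x : E →ₗ[ℝ] Z)) = n

/-- The subset `Y` of the open set `Ω ⊆ E` has meagre codimension `n` in `Ω` (for `n ≥ 1`): its image
under every nonlinear projection of codimension `n - 1` is meagre in the target subspace. -/
def HasMeagreCodimIn (Ω Y : Set E) (n : ℕ) : Prop :=
  ∀ m : ℕ, m + 1 = n → ∀ (Z : Submodule ℝ E) (π : E → Z),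
    IsNonlinearProjection Ω Z m π → IsMeagre (π '' Y)

/-- A subset `Y` of a `C^k` Banach manifold `X` modelled on `E` has meagre codimension `n` if in every
chart `φ` (every member of the maximal `C^k` atlas) the set `φ (U ∩ Y)` has meagre codimension `n`
in `φ (U)`, where `U` is the domain of `φ`. -/
def HasMeagreCodim (E : Type*) [NormedAddCommGroup E] [NormedSpace ℝ E] (k : WithTop ℕ∞)
    {X : Type*} [TopologicalSpace X] [ChartedSpace E X] (Y : Set X) (n : ℕ) : Prop :=
  ∀ φ ∈ IsManifold.maximalAtlas 𝓘(ℝ, E) k X,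
    HasMeagreCodimIn φ.target (φ '' (φ.source ∩ Y)) n

end Codimension

section Operators

variable {H : Type*} [NormedAddCommGroup H] [NormedSpace ℝ H]

/-- The continuous bilinear form `g` is an inner product on `H` inducing a norm equivalent to the
given one.  (The bound `g v v ≤ C * ‖v‖ ^ 2` is the continuity of `g`.) -/
structure IsEquivInner (g : H →L[ℝ] H →L[ℝ] ℝ) : Prop where
  symm : ∀ v w, g v w = g w v
  coercive : ∃ c : ℝ, 0 < c ∧ ∀ v, c * ‖v‖ ^ 2 ≤ g v v

/-- The unbounded operator `A` is densely defined and self-adjoint for the inner product `g`: it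
has the same graph as its adjoint.  The adjoint relates `y` to `z` iff
`⟨A x, y⟩ = ⟨x, z⟩` for all `x` in the domain of `A`. -/
structure IsSelfAdjointFor (g : H →L[ℝ] H →L[ℝ] ℝ) (A : H →ₗ.[ℝ] H) : Prop where
  dense : Dense (A.domain : Set H)
  adjoint_graph : ∀ y z : H,
    (∀ x : A.domain, g (A x) y = g (x : H) z) ↔ (y, z) ∈ A.graph

/-- The bounded operator `R` is a two-sided inverse of `μ - A : A.domain → H`. -/
structure IsResolventOf (A : H →ₗ.[ℝ] H) (μ : ℝ) (R : H →L[ℝ] H) : Prop where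
  left_inv : ∀ x : A.domain, R (μ • (x : H) - A x) = x
  mem_domain : ∀ y, R y ∈ A.domain
  right_inv : ∀ y, μ • R y - A ⟨R y, mem_domain y⟩ = y

/-- The resolvent set of `A` (its real points; the spectrum of a self-adjoint operator is real). -/
def resolventSet (A : H →ₗ.[ℝ] H) : Set ℝ := {μ | ∃ R, IsResolventOf A μ R}

/-- The spectrum of `A`. -/
def spectrum (A : H →ₗ.[ℝ] H) : Set ℝ := (resolventSet A)ᶜ

open Classical in
/-- The resolvent `(μ - A)⁻¹`, for `μ` in the resolvent set (and `0` otherwise). -/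
def resolvent (A : H →ₗ.[ℝ] H) (μ : ℝ) : H →L[ℝ] H :=
  if h : μ ∈ resolventSet A then h.choose else 0

/-- The eigenspace `{x ∈ dom A | A x = l x}`. -/
def eigenspace (A : H →ₗ.[ℝ] H) (l : ℝ) : Submodule ℝ H where
  carrier := {x | (x, l • x) ∈ A.graph}
  add_mem' {x y} hx hy := by
    simpa [smul_add] using A.graph.add_mem hx hy
  zero_mem' := by
    change ((0 : H), l • (0 : H)) ∈ A.graph
    rw [smul_zero]
    exact A.graph.zero_mem
  smul_mem' c x hx := by
    simpa [smul_comm c l x] using A.graph.smul_mem c hx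

/-- The spectrum of `A` is discrete and of finite multiplicity: it consists of eigenvalues with
finite-dimensional eigenspaces and it has no accumulation point in `ℝ`. -/
structure HasDiscreteSpectrum (A : H →ₗ.[ℝ] H) : Prop where
  eigenvalue : ∀ l ∈ spectrum A, eigenspace A l ≠ ⊥
  finite_mult : ∀ l ∈ spectrum A, FiniteDimensional ℝ (eigenspace A l)
  no_accPt : ∀ x : ℝ, ¬ AccPt x (𝓟 (spectrum A))

/-- `A` has a repeated eigenvalue, i.e. an eigenvalue of multiplicity at least `2`. -/
def HasRepeatedEigenvalue (A : H →ₗ.[ℝ] H) : Prop :=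
  ∃ l : ℝ, 2 ≤ Module.rank ℝ (eigenspace A l)

end Operators

section Families

variable {E : Type*} [NormedAddCommGroup E] [NormedSpace ℝ E]
  {X : Type*} [TopologicalSpace X] [ChartedSpace E X]
  {H : Type*} [NormedAddCommGroup H] [NormedSpace ℝ H]

variable (E) in
/-- The resolvents of the family `A` depend Fréchet-differentiably on the parameter: whenever `μ` is
in the resolvent set of `A q`, it is in that of `A p` for all `p` near `q`, and the map
`p ↦ (μ - A p)⁻¹` into the bounded operators is differentiable at `q`. -/
def ResolventsDifferentiable (A : X → H →ₗ.[ℝ] H) : Prop :=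
  ∀ (q : X) (μ : ℝ), μ ∈ resolventSet (A q) →
    (∀ᶠ p in 𝓝 q, μ ∈ resolventSet (A p)) ∧
    MDifferentiableAt 𝓘(ℝ, E) 𝓘(ℝ, H →L[ℝ] H) (fun p => resolvent (A p) μ) q

variable (E) in
/-- The derivative at `q` of `p ↦ (μ - A p)⁻¹`, as a map from the tangent space at `q` to the
bounded operators. -/
def resolventDeriv (A : X → H →ₗ.[ℝ] H) (μ : ℝ) (q : X) :
    TangentSpace 𝓘(ℝ, E) q →L[ℝ] (H →L[ℝ] H) :=
  mfderiv 𝓘(ℝ, E) 𝓘(ℝ, H →L[ℝ] H) (fun p => resolvent (A p) μ) q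

variable (E) in
/-- The linear functional `h ↦ ⟨R'(q)[h] v, w⟩_q` on the tangent space at `q`, where
`R(p) = (μ - A p)⁻¹`. -/
def derivEntry (g : X → H →L[ℝ] H →L[ℝ] ℝ) (A : X → H →ₗ.[ℝ] H) (μ : ℝ) (q : X) (v w : H) :
    TangentSpace 𝓘(ℝ, E) q →ₗ[ℝ] ℝ where
  toFun h := g q (resolventDeriv E A μ q h v) w
  map_add' h h' := by simp
  map_smul' c h := by simp

variable (E) in
/-- The condition SAH2: for every parameter `q` and every eigenvalue `l` of `A q` of multiplicity at
least `2` there are two eigenvectors `v₁, v₂` for `l`, orthonormal for the inner product at `q`, such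
that the functionals `f'₁₁ - f'₂₂` and `f'₁₂` on the tangent space at `q` are linearly independent,
where `f'ᵢⱼ(h) = ⟨R'(q)[h] vᵢ, vⱼ⟩_q` for some resolvent `R(p) = (μ - A p)⁻¹`. -/
def SAH2 (g : X → H →L[ℝ] H →L[ℝ] ℝ) (A : X → H →ₗ.[ℝ] H) : Prop :=
  ∀ (q : X) (l : ℝ), 2 ≤ Module.rank ℝ (eigenspace (A q) l) →
    ∃ μ ∈ resolventSet (A q), ∃ v₁ ∈ eigenspace (A q) l, ∃ v₂ ∈ eigenspace (A q) l,
      g q v₁ v₁ = 1 ∧ g q v₂ v₂ = 1 ∧ g q v₁ v₂ = 0 ∧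
      LinearIndependent ℝ
        ![derivEntry E g A μ q v₁ v₁ - derivEntry E g A μ q v₂ v₂, derivEntry E g A μ q v₁ v₂]

end Families

end MeagreCodim

end

/-
Let `T` be symmetric with an isolated eigenvalue `κ` of finite multiplicity, let `S = T - κ`, and
let `S'` be close to `S` with a kernel of the same dimension. Then the vectors of `ker S` are
within `O(‖S' - S‖)` of `ker S'`, so the compression of `S' - S` to `ker S` is `O(‖S' - S‖²)`. If
`κ'` is an eigenvalue of `T'` of the same multiplicity, take `S' = T' - κ'`: the scalar `κ' - κ`
disappears from the trace-free part of the compression of `T' - T` to the span of two orthonormal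
eigenvectors, which is thus `O(‖T' - T‖²)`. When `T` is the resolvent at a parameter, condition
SAH2 says that this trace-free part depends on the parameter with a derivative onto `ℝ²`. Hence
the set of parameters at which an eigenvalue near `l` has the same multiplicity as `l` is tangent
to a subspace of codimension two, and countably many such sets cover the parameters with a
repeated eigenvalue.

For a set tangent at `y` to a subspace of codimension `n` and a projection `π` with
`dim ker π' < n`, there are a finite-dimensional `U ⊆ Z` and a bounded linear map `τ` into a space
of dimension less than `dim U`, both from countable families, such that
  `π y' - π y = O(‖π y' - π y mod U‖ + ‖τ (y' - y)‖)`
on the set. On a piece where this is uniform, the part of the image in any translate of `U` is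
parametrized by `τ` with a Lipschitz inverse, so its Hausdorff dimension is less than `dim U` and
the image is nowhere dense.
-/

noncomputable section

namespace MeagreCodim

open Module

section Dimension

variable {U F : Type*} [NormedAddCommGroup U] [NormedSpace ℝ U] [FiniteDimensional ℝ U]
  [NormedAddCommGroup F] [NormedSpace ℝ F] [FiniteDimensional ℝ F]

theorem finrank_le_of_norm_sub_le {s : Set U} (hs : (interior s).Nonempty) {t : U → F} {C : ℝ}
    (ht : ∀ u ∈ s, ∀ v ∈ s, ‖u - v‖ ≤ C * ‖t u - t v‖) : finrank ℝ U ≤ finrank ℝ F := by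
  have hanti : AntilipschitzWith C.toNNReal (s.domRestrict t) :=
    AntilipschitzWith.of_le_mul_dist fun u v => by
      simp only [Subtype.dist_eq, dist_eq_norm]
      exact (ht u u.2 v v.2).trans
        (mul_le_mul_of_nonneg_right (Real.le_coe_toNNReal C) (norm_nonneg _))
  have hdim : (finrank ℝ U : ENNReal) ≤ finrank ℝ F := calc
    (finrank ℝ U : ENNReal) = dimH s := (Real.dimH_of_nonempty_interior hs).symm
    _ = dimH (univ : Set s) := by
      rw [← Isometry.dimH_image (f := ((↑) : s → U)) isometry_subtype_coe, image_univ,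
        Subtype.range_coe]
    _ ≤ dimH (s.domRestrict t '' univ) := hanti.le_dimH_image _
    _ ≤ dimH (univ : Set F) := dimH_mono (subset_univ _)
    _ = finrank ℝ F := Real.dimH_univ_eq_finrank F
  exact_mod_cast hdim

end Dimension

section NowhereDense

theorem closure_image_fst_subset {Z F : Type*} [PseudoMetricSpace Z] [PseudoMetricSpace F]
    [ProperSpace F] {S : Set (Z × F)} (hS : Bornology.IsBounded (Prod.snd '' S)) :
    closure (Prod.fst '' S) ⊆ Prod.fst '' closure S := by
  intro z hz
  obtain ⟨x, hx, hxz⟩ := mem_closure_iff_seq_limit.1 hz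
  choose p hp hpx using hx
  obtain ⟨t, -, φ, hφ, ht⟩ := tendsto_subseq_of_bounded hS fun n => mem_image_of_mem _ (hp n)
  refine ⟨(z, t), mem_closure_of_tendsto (b := atTop) (f := p ∘ φ) ?_
    (Eventually.of_forall fun n => hp (φ n)), rfl⟩
  rw [nhds_prod_eq]
  refine Tendsto.prodMk (f := atTop) ?_ ht
  simpa only [Function.comp_def, hpx] using hxz.comp hφ.tendsto_atTop

variable {Z F : Type*} [NormedAddCommGroup Z] [NormedSpace ℝ Z]
  [NormedAddCommGroup F] [NormedSpace ℝ F] [FiniteDimensional ℝ F]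

theorem isNowhereDense_image_fst {U : Submodule ℝ Z}
    (hU : finrank ℝ F < finrank ℝ U) {S : Set (Z × F)}
    (hS : Bornology.IsBounded (Prod.snd '' S)) {C : ℝ}
    (hC : ∀ a ∈ S, ∀ b ∈ S, ‖b.1 - a.1‖ ≤ C * ‖(U.mkQL (b.1 - a.1), b.2 - a.2)‖) :
    IsNowhereDense (Prod.fst '' S) := by
  have : FiniteDimensional ℝ U := .of_finrank_pos (Nat.zero_lt_of_lt hU)
  have hC' : ∀ a ∈ closure S, ∀ b ∈ closure S,
      ‖b.1 - a.1‖ ≤ C * ‖(U.mkQL (b.1 - a.1), b.2 - a.2)‖ := by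
    have hclosed : IsClosed {p : (Z × F) × Z × F | ‖p.2.1 - p.1.1‖ ≤
        C * ‖(U.mkQL (p.2.1 - p.1.1), p.2.2 - p.1.2)‖} :=
      isClosed_le (by fun_prop) (by fun_prop)
    intro a ha b hb
    refine closure_minimal (s := S ×ˢ S) (fun p hp => hC _ hp.1 _ hp.2) hclosed
      (?_ : (a, b) ∈ _)
    rw [closure_prod_eq]
    exact ⟨ha, hb⟩
  by_contra hne
  obtain ⟨z, hz⟩ := nonempty_iff_ne_empty.2 hne
  have hlift : ∀ u : U, z + u ∈ closure (Prod.fst '' S) → ∃ t : F, (z + u, t) ∈ closure S := by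
    intro u hu
    obtain ⟨p, hp, hpu⟩ := closure_image_fst_subset hS hu
    exact ⟨p.2, hpu ▸ hp⟩
  choose! t ht using hlift
  refine hU.not_ge (finrank_le_of_norm_sub_le
    (s := (fun u : U => z + u) ⁻¹' closure (Prod.fst '' S)) (t := t) (C := C) ?_ ?_)
  · refine ⟨0, preimage_interior_subset_interior_preimage (by fun_prop) ?_⟩
    simpa using hz
  · intro u hu v hv
    have h := hC' _ (ht v hv) _ (ht u hu)
    have hmk : U.mkQL ((u : Z) - v) = 0 := (Submodule.Quotient.mk_eq_zero U).2 (u - v).2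
    rwa [add_sub_add_left_eq_sub, hmk, Prod.norm_mk, norm_zero, max_eq_right (norm_nonneg _)] at h

theorem isMeagre_image_of_nhdsWithin {X Z : Type*} [TopologicalSpace X]
    [SecondCountableTopology X] [TopologicalSpace Z] {f : X → Z} {Y : Set X}
    (h : ∀ y ∈ Y, ∃ t ∈ 𝓝[Y] y, IsMeagre (f '' t)) : IsMeagre (f '' Y) := by
  choose! t ht hmeagre using h
  obtain ⟨s, hsY, hs, hcover⟩ := TopologicalSpace.countable_cover_nhdsWithin ht
  refine (isMeagre_biUnion hs fun y hy => hmeagre y (hsY hy)).mono ?_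
  rw [← image_iUnion₂]
  exact image_mono hcover

theorem isMeagre_image_of_isBigO {E : Type*} [NormedAddCommGroup E] [NormedSpace ℝ E]
    [SecondCountableTopology E] {U : Submodule ℝ Z}
    (hU : finrank ℝ F < finrank ℝ U) (τ : E →L[ℝ] F) {f : E → Z} {Y : Set E}
    (h : ∀ y ∈ Y, (fun y' => f y' - f y) =O[𝓝[Y] y] fun y' =>
      (U.mkQL (f y' - f y), τ (y' - y))) :
    IsMeagre (f '' Y) := by
  let Yn : ℕ → Set E := fun n => {y ∈ Y | ∀ y' ∈ Y, dist y' y < 1 / (n + 1) →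
    ‖f y' - f y‖ ≤ n * ‖(U.mkQL (f y' - f y), τ (y' - y))‖}
  have hcover : Y ⊆ ⋃ n, Yn n := by
    intro y hy
    obtain ⟨C, hC⟩ := (h y hy).bound
    obtain ⟨ε, hε, hball⟩ := Metric.mem_nhdsWithin_iff.1 hC
    obtain ⟨n, hn, hCn⟩ := ((tendsto_one_div_add_atTop_nhds_zero_nat (𝕜 := ℝ)).eventually_lt_const
      hε |>.and (tendsto_natCast_atTop_atTop.eventually_ge_atTop C)).exists
    refine mem_iUnion.2 ⟨n, hy, fun y' hy' hdist => ?_⟩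
    exact (hball ⟨hdist.trans hn, hy'⟩ : _ ≤ _).trans
      (mul_le_mul_of_nonneg_right hCn (by positivity))
  have hpiece : ∀ n, IsMeagre (f '' Yn n) := by
    intro n
    refine isMeagre_image_of_nhdsWithin fun y _ =>
      ⟨Yn n ∩ Metric.ball y (1 / (n + 1) / 2), inter_mem self_mem_nhdsWithin
        (mem_nhdsWithin_of_mem_nhds (Metric.ball_mem_nhds y (by positivity))), ?_⟩
    let S := (fun y' => (f y', τ y')) '' (Yn n ∩ Metric.ball y (1 / (n + 1) / 2))
    have hS : IsNowhereDense (Prod.fst '' S) := by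
      refine isNowhereDense_image_fst hU (C := n) ?_ ?_
      · rw [image_image]
        exact τ.lipschitz.isBounded_image (Metric.isBounded_ball.subset inter_subset_right)
      · rintro _ ⟨a, ha, rfl⟩ _ ⟨b, hb, rfl⟩
        rw [← map_sub]
        refine ha.1.2 b hb.1.1 ?_
        linarith [dist_triangle_right b a y, Metric.mem_ball.1 ha.2, Metric.mem_ball.1 hb.2]
    simpa only [S, image_image] using hS.isMeagre
  refine (isMeagre_iUnion hpiece).mono ?_
  rw [← image_iUnion]
  exact image_mono hcover

end NowhereDense

section Separable

theorem exists_finset_isCompl_span {Z ι : Type*} [NormedAddCommGroup Z] [NormedSpace ℝ Z]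
    {z : ι → Z} (hz : DenseRange z) {N : Submodule ℝ Z} (hN : IsClosed (N : Set Z))
    [FiniteDimensional ℝ (Z ⧸ N)] : ∃ s : Finset ι, IsCompl (Submodule.span ℝ (z '' s)) N := by
  obtain ⟨b, -, -, hspan, hb⟩ := exists_linearIndepOn_extension (K := ℝ) (v := N.mkQ ∘ z)
    (linearIndepOn_empty ℝ _) (empty_subset univ)
  have hfin : b.Finite := hb.finite
  lift b to Finset ι using hfin
  have hdense : Dense ((Submodule.span ℝ (N.mkQ ∘ z '' b) : Submodule ℝ (Z ⧸ N)) : Set (Z ⧸ N)) :=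
    ((N.isOpenQuotientMap_mkQL.surjective.denseRange).comp hz N.mkQL.continuous).mono
      (image_univ ▸ hspan)
  refine ⟨b, image_eq_range z b ▸ ?_, codisjoint_iff.2 ?_⟩
  · simpa using Submodule.range_ker_disjoint (f := N.mkQ) (v := fun i : b => z i) hb
  · rw [sup_comm, ← Submodule.map_mkQ_eq_top, Submodule.map_span, ← image_comp]
    exact SetLike.coe_injective
      ((Submodule.closed_of_finiteDimensional _).closure_eq.symm.trans hdense.closure_eq)

theorem exists_seq_separating_dual (E : Type*) [NormedAddCommGroup E] [NormedSpace ℝ E]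
    [TopologicalSpace.SeparableSpace E] :
    ∃ τ : ℕ → E →L[ℝ] ℝ, ∀ x, (∀ n, τ n x = 0) → x = 0 := by
  choose τ hτ hτx using fun n : ℕ => exists_dual_vector'' ℝ (TopologicalSpace.denseSeq E n)
  refine ⟨τ, fun x hx => norm_le_zero_iff.1 ?_⟩
  have hclosed : IsClosed {z : E | ‖x‖ ≤ 2 * ‖x - z‖} := isClosed_le (by fun_prop) (by fun_prop)
  suffices ∀ z, ‖x‖ ≤ 2 * ‖x - z‖ by simpa using this x
  refine fun z => (TopologicalSpace.denseRange_denseSeq E).induction_on z hclosed fun n => ?_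
  set z := TopologicalSpace.denseSeq E n
  have hz : ‖z‖ ≤ ‖z - x‖ := calc
    ‖z‖ = τ n (z - x) := by rw [map_sub, hx, sub_zero, hτx]; rfl
    _ ≤ ‖z - x‖ := ((le_abs_self _).trans ((τ n).le_of_opNorm_le (hτ n) _)).trans_eq (one_mul _)
  linarith [norm_le_norm_add_norm_sub' x z, norm_sub_rev x z]

theorem exists_finset_separating {E ι : Type*} [NormedAddCommGroup E] [NormedSpace ℝ E]
    {τ : ι → E →L[ℝ] ℝ} (hτ : ∀ x, (∀ i, τ i x = 0) → x = 0) (K : Submodule ℝ E)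
    [FiniteDimensional ℝ K] :
    ∃ s : Finset ι, s.card ≤ finrank ℝ K ∧ ∀ x ∈ K, (∀ i ∈ s, τ i x = 0) → x = 0 := by
  let v : ι → Dual ℝ K := fun i => (τ i : E →ₗ[ℝ] ℝ).domRestrict K
  obtain ⟨b, -, -, hspan, hb⟩ := exists_linearIndepOn_extension (K := ℝ) (v := v)
    (linearIndepOn_empty ℝ _) (empty_subset univ)
  have hfin : b.Finite := hb.finite
  lift b to Finset ι using hfin
  refine ⟨b, ?_, fun x hx hbx => hτ x fun i => ?_⟩
  · simpa using hb.fintype_card_le_finrank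
  · have hle : Submodule.span ℝ (v '' b) ≤ LinearMap.ker (LinearMap.applyₗ (⟨x, hx⟩ : K)) :=
      Submodule.span_le.2 (by rintro _ ⟨j, hj, rfl⟩; exact hbx j hj)
    exact hle (hspan ⟨i, mem_univ i, rfl⟩)

end Separable

section Surjections

theorem exists_antilipschitzWith_prod {X Y G : Type*} [NormedAddCommGroup X] [NormedSpace ℝ X]
    [CompleteSpace X] [NormedAddCommGroup Y] [NormedSpace ℝ Y] [CompleteSpace Y]
    [NormedAddCommGroup G] [NormedSpace ℝ G] {T : X →L[ℝ] Y} (hT : Function.Surjective T)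
    [FiniteDimensional ℝ T.ker] {M : X →L[ℝ] G} (hM : ∀ x, T x = 0 → M x = 0 → x = 0) :
    ∃ C, AntilipschitzWith C (T.prod M) := by
  obtain ⟨j, -⟩ := T.exists_nonlinearRightInverse_of_surjective (LinearMap.range_eq_top.2 hT)
  have hker : LinearMap.ker ((M : X →ₗ[ℝ] G).domRestrict T.ker) = ⊥ :=
    LinearMap.ker_eq_bot'.2 fun x hx => Subtype.ext (hM x x.2 hx)
  obtain ⟨K, -, hK⟩ := LinearMap.exists_antilipschitzWith _ hker
  refine ⟨j.nnnorm + K * (1 + ‖M‖₊ * j.nnnorm),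
    ContinuousLinearMap.antilipschitz_of_bound _ fun x => ?_⟩
  have hj : ‖j (T x)‖ ≤ j.nnnorm * ‖T x‖ := j.bound (T x)
  have hmem : T (x - j (T x)) = 0 := by rw [map_sub, j.right_inv, sub_self]
  have hrest : ‖x - j (T x)‖ ≤ K * ‖M (x - j (T x))‖ :=
    hK.le_mul_norm (map_zero _) (⟨x - j (T x), hmem⟩ : T.ker)
  have hM' : ‖M (x - j (T x))‖ ≤ ‖M x‖ + ‖M‖ * (j.nnnorm * ‖T x‖) := by
    rw [map_sub]
    exact (norm_sub_le _ _).trans (by gcongr; exact M.le_opNorm_of_le hj)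
  have hTx : ‖T x‖ ≤ ‖T.prod M x‖ := norm_fst_le (T.prod M x)
  have hMx : ‖M x‖ ≤ ‖T.prod M x‖ := norm_snd_le (T.prod M x)
  calc ‖x‖ ≤ ‖j (T x)‖ + ‖x - j (T x)‖ := norm_le_norm_add_norm_sub' _ _
    _ ≤ j.nnnorm * ‖T x‖ + K * (‖M x‖ + ‖M‖ * (j.nnnorm * ‖T x‖)) := by
      gcongr; exact hrest.trans (by gcongr)
    _ ≤ j.nnnorm * ‖T.prod M x‖ + K * (‖T.prod M x‖ + ‖M‖ * (j.nnnorm * ‖T.prod M x‖)) := by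
      gcongr
    _ = ↑(j.nnnorm + K * (1 + ‖M‖₊ * j.nnnorm)) * ‖T.prod M x‖ := by
      push_cast; ring

/-- A linear surjection `f` identifies the quotient of its target by the image of `p` with the
quotient of its source by `p ⊔ ker f`. -/
def quotientMapEquiv {R V W : Type*} [Ring R] [AddCommGroup V] [Module R V] [AddCommGroup W]
    [Module R W] (f : V →ₗ[R] W) (hf : Function.Surjective f) (p : Submodule R V) :
    (V ⧸ (p ⊔ LinearMap.ker f)) ≃ₗ[R] W ⧸ p.map f :=
  Submodule.quotEquivOfEq _ _
      (by rw [LinearMap.ker_comp, Submodule.ker_mkQ, Submodule.comap_map_eq])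
    ≪≫ₗ ((p.map f).mkQ ∘ₗ f).quotKerEquivOfSurjective ((p.map f).mkQ_surjective.comp hf)

section Quotients

variable {K V W F : Type*} [Field K] [AddCommGroup V] [Module K V] [AddCommGroup W] [Module K W]
  [AddCommGroup F] [Module K F] {f : V →ₗ[K] W} {g : V →ₗ[K] F}

/-- For two linear surjections `f` and `g` on the same space, the cokernels of `f` on `ker g` and of
`g` on `ker f` are identified: both are the quotient by `ker f ⊔ ker g`. -/
def quotientMapKerEquiv (hf : Function.Surjective f) (hg : Function.Surjective g) :
    (W ⧸ (LinearMap.ker g).map f) ≃ₗ[K] F ⧸ (LinearMap.ker f).map g :=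
  (quotientMapEquiv f hf _).symm ≪≫ₗ Submodule.quotEquivOfEq _ _ (sup_comm _ _) ≪≫ₗ
    quotientMapEquiv g hg _

theorem finrank_ker_inf_ker_lt [FiniteDimensional K F] [FiniteDimensional K (LinearMap.ker f)]
    (hf : Function.Surjective f) (hg : Function.Surjective g)
    (h : finrank K (LinearMap.ker f) < finrank K F) :
    finrank K ↥(LinearMap.ker f ⊓ LinearMap.ker g) <
      finrank K (W ⧸ (LinearMap.ker g).map f) := by
  have hquot := (quotientMapKerEquiv hf hg).finrank_eq
  have hF := ((LinearMap.ker f).map g).finrank_quotient_add_finrank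
  have hker := (g.domRestrict (LinearMap.ker f)).finrank_range_add_finrank_ker
  rw [LinearMap.range_domRestrict, LinearMap.ker_domRestrict,
    ← Submodule.finrank_map_subtype_eq, Submodule.map_comap_subtype] at hker
  omega

end Quotients

theorem isClosed_map {E Z : Type*} [NormedAddCommGroup E] [NormedSpace ℝ E]
    [CompleteSpace E] [NormedAddCommGroup Z] [NormedSpace ℝ Z] [CompleteSpace Z]
    {D : E →L[ℝ] Z} (hD : Function.Surjective D) [FiniteDimensional ℝ D.ker]
    {p : Submodule ℝ E} (hp : IsClosed (p : Set E)) :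
    IsClosed (p.map (D : E →ₗ[ℝ] Z) : Set Z) := by
  have hquot : IsQuotientMap D := (D.isOpenMap hD).isQuotientMap D.continuous hD
  rw [← hquot.isClosed_preimage]
  change IsClosed ((p.map (D : E →ₗ[ℝ] Z)).comap (D : E →ₗ[ℝ] Z) : Set E)
  rw [Submodule.comap_map_eq]
  exact Submodule.isClosed_sup_finiteDimensional _ _ hp

variable {E F Z ι κ : Type*} [NormedAddCommGroup E] [NormedSpace ℝ E] [CompleteSpace E]
  [NormedAddCommGroup Z] [NormedSpace ℝ Z] [CompleteSpace Z] [NormedAddCommGroup F]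
  [NormedSpace ℝ F] [FiniteDimensional ℝ F]

theorem exists_antilipschitzWith_of_finrank_ker_lt {z : ι → Z} (hz : DenseRange z)
    {τ : κ → E →L[ℝ] ℝ}
    (hτ : ∀ x, (∀ i, τ i x = 0) → x = 0) {D : E →L[ℝ] Z} (hD : Function.Surjective D)
    [FiniteDimensional ℝ D.ker] {L : E →L[ℝ] F} (hL : Function.Surjective L)
    (hdim : finrank ℝ D.ker < finrank ℝ F) :
    ∃ (s : Finset ι) (t : Finset κ), t.card < finrank ℝ (Submodule.span ℝ (z '' s)) ∧
      ∃ C, AntilipschitzWith C (((Submodule.span ℝ (z '' s)).mkQL ∘L D).prod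
        ((ContinuousLinearMap.pi fun i : t => τ i).prod L)) := by
  have hclosed := isClosed_map hD L.isClosed_ker
  have : FiniteDimensional ℝ (Z ⧸ L.ker.map (D : E →ₗ[ℝ] Z)) :=
    Module.Finite.equiv (quotientMapKerEquiv hD hL).symm
  obtain ⟨s, hs⟩ := exists_finset_isCompl_span hz hclosed
  obtain ⟨t, htcard, ht⟩ := exists_finset_separating hτ (D.ker ⊓ L.ker)
  set U := Submodule.span ℝ (z '' s)
  have hU : finrank ℝ (Z ⧸ L.ker.map (D : E →ₗ[ℝ] Z)) = finrank ℝ U :=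
    (Submodule.quotientEquivOfIsCompl _ _ hs.symm).finrank_eq
  refine ⟨s, t, htcard.trans_lt ((finrank_ker_inf_ker_lt hD hL hdim).trans_eq hU), ?_⟩
  have hUfin : FiniteDimensional ℝ U := FiniteDimensional.span_of_finite ℝ (s.finite_toSet.image z)
  have : IsClosed (U : Set Z) := U.closed_of_finiteDimensional
  have hker : (U.mkQL ∘L D).ker = U.comap (D : E →ₗ[ℝ] Z) := by
    ext x
    exact Submodule.Quotient.mk_eq_zero U
  have : FiniteDimensional ℝ (U.mkQL ∘L D).ker := hker ▸ inferInstance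
  refine exists_antilipschitzWith_prod (U.mkQ_surjective.comp hD) fun h hUh hMh => ?_
  obtain ⟨hth, hLh⟩ := Prod.ext_iff.1 hMh
  have hDh : D h = 0 := hs.disjoint.le_bot
    ⟨(Submodule.Quotient.mk_eq_zero U).1 hUh, h, hLh, rfl⟩
  exact ht h ⟨hDh, hLh⟩ fun i hi => congrFun hth ⟨i, hi⟩

end Surjections

section Tangency

variable {E : Type*} [NormedAddCommGroup E] [NormedSpace ℝ E]

/-- The set `W` is tangent at `y` to a closed linear subspace of codimension `n`, which is encoded
as the kernel of a bounded linear map `L` onto `ℝⁿ`: the points `y'` of `W` satisfy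
`L (y' - y) = o(‖y' - y‖)` as `y' → y`. The point `y` need not be in `W`. -/
def HasTangentCodim (W : Set E) (y : E) (n : ℕ) : Prop :=
  ∃ L : E →L[ℝ] Fin n → ℝ, Function.Surjective L ∧
    (fun y' => L (y' - y)) =o[𝓝[W] y] fun y' => y' - y

theorem HasTangentCodim.mono {V W : Set E} {y : E} {n : ℕ} (h : HasTangentCodim W y n)
    (hVW : V ⊆ W) : HasTangentCodim V y n := by
  obtain ⟨L, hL, ho⟩ := h
  exact ⟨L, hL, ho.mono (nhdsWithin_mono y hVW)⟩

variable {Z G F K : Type*} [NormedAddCommGroup Z] [NormedSpace ℝ Z] [SeminormedAddCommGroup G]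
  [NormedSpace ℝ G] [NormedAddCommGroup F] [NormedSpace ℝ F] [NormedAddCommGroup K]
  [NormedSpace ℝ K]

theorem isBigO_sub_of_antilipschitzWith {f : E → Z} {D : E →L[ℝ] Z} {y : E}
    (hf : HasFDerivAt f D y) {W : Set E} {L : E →L[ℝ] F}
    (hL : (fun y' => L (y' - y)) =o[𝓝[W] y] fun y' => y' - y) {Q : Z →L[ℝ] G} {τ : E →L[ℝ] K}
    {C : NNReal} (hC : AntilipschitzWith C ((Q ∘L D).prod (τ.prod L))) :
    (fun y' => f y' - f y) =O[𝓝[W] y] fun y' => (Q (f y' - f y), τ (y' - y)) := by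
  have hsub : (fun y' => f y' - f y) =O[𝓝[W] y] fun y' => y' - y :=
    hf.isBigO_sub.mono nhdsWithin_le_nhds
  have hΦ : (fun y' => y' - y) =O[𝓝[W] y] fun y' => (Q ∘L D).prod (τ.prod L) (y' - y) :=
    .of_bound C (Eventually.of_forall fun y' => hC.le_mul_norm (map_zero _) _)
  have herr : (fun y' => (Q (D (y' - y) - (f y' - f y)), ((0 : K), L (y' - y)))) =o[𝓝[W] y]
      fun y' => y' - y := by
    refine .prod_left ?_ (.prod_left (Asymptotics.isLittleO_zero _ _) hL)
    refine (Q.isBigO_comp _ _).trans_isLittleO ?_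
    simpa only [neg_sub] using (hf.isLittleO.mono nhdsWithin_le_nhds).neg_left
  refine (hsub.trans hΦ).trans (((herr.trans_isBigO hΦ).right_isBigO_sub).trans ?_)
  refine .of_bound 1 (Eventually.of_forall fun y' => ?_)
  simp [Prod.norm_mk]

variable [CompleteSpace E] [TopologicalSpace.SeparableSpace E]

theorem hasMeagreCodimIn_of_hasTangentCodim {ι : Type*} [Countable ι] (W : ι → Set E)
    {Ω Y : Set E} (hYΩ : Y ⊆ Ω) {n : ℕ} (hY : ∀ y ∈ Y, ∃ i, y ∈ W i ∧ HasTangentCodim (W i) y n) :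
    HasMeagreCodimIn Ω Y n := by
  rintro m rfl Z π hπ
  have : SecondCountableTopology E := UniformSpace.secondCountable_of_separable E
  have : CompleteSpace Z := hπ.isClosed.completeSpace_coe
  obtain ⟨τ, hτ⟩ := exists_seq_separating_dual E
  let z := TopologicalSpace.denseSeq Z
  let U : Finset ℕ → Submodule ℝ Z := fun s => Submodule.span ℝ (z '' s)
  let T : (t : Finset ℕ) → E →L[ℝ] t → ℝ := fun t => ContinuousLinearMap.pi fun i => τ i
  let P : ι × Finset ℕ × Finset ℕ → Set E := fun j => {y ∈ W j.1 |
    j.2.2.card < finrank ℝ (U j.2.1) ∧ (fun y' => π y' - π y) =O[𝓝[W j.1] y] fun y' =>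
      ((U j.2.1).mkQL (π y' - π y), T j.2.2 (y' - y))}
  have hcover : Y ⊆ ⋃ j, P j := by
    intro y hy
    obtain ⟨i, hyi, L, hL, ho⟩ := hY y hy
    have hrank := hπ.rank_ker y (hYΩ hy)
    have : FiniteDimensional ℝ (fderiv ℝ π y).ker := finite_of_rank_eq_nat hrank
    obtain ⟨s, t, hst, C, hC⟩ := exists_antilipschitzWith_of_finrank_ker_lt
      (TopologicalSpace.denseRange_denseSeq Z) hτ (hπ.surjective y (hYΩ hy)) hL
      (by rw [finrank_eq_of_rank_eq hrank]; simp)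
    exact mem_iUnion.2 ⟨(i, s, t), hyi, hst, isBigO_sub_of_antilipschitzWith
      (hπ.differentiableAt y (hYΩ hy)).hasFDerivAt ho hC⟩
  refine (isMeagre_iUnion fun j => ?_ : IsMeagre (⋃ j, π '' P j)).mono ?_
  · rcases (P j).eq_empty_or_nonempty with hPj | ⟨y, hyj⟩
    · rw [hPj, image_empty]
      exact IsMeagre.empty
    · refine isMeagre_image_of_isBigO (U := U j.2.1) ?_ (T j.2.2) fun y hy =>
        hy.2.2.mono (nhdsWithin_mono y fun _ h => h.1)
      simpa using hyj.2.1
  · rw [← image_iUnion]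
    exact image_mono hcover

end Tangency

section Resolvent

variable {H : Type*} [NormedAddCommGroup H] [NormedSpace ℝ H] {A : H →ₗ.[ℝ] H} {μ : ℝ}
  {R : H →L[ℝ] H}

theorem isResolventOf_resolvent (hμ : μ ∈ resolventSet A) : IsResolventOf A μ (resolvent A μ) := by
  rw [resolvent, dif_pos hμ]
  exact hμ.choose_spec

theorem mem_eigenspace_iff {l : ℝ} {x : H} :
    x ∈ eigenspace A l ↔ ∃ hx : x ∈ A.domain, A ⟨x, hx⟩ = l • x := by
  change (x, l • x) ∈ A.graph ↔ _
  simp [LinearPMap.mem_graph_iff]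

namespace IsResolventOf

theorem apply_map (hR : IsResolventOf A μ R) (x : H) :
    A ⟨R x, hR.mem_domain x⟩ = μ • R x - x :=
  eq_sub_iff_add_eq'.2 (sub_eq_iff_eq_add.1 (hR.right_inv x)).symm

theorem mem_eigenspace_iff_smul_eq (hR : IsResolventOf A μ R) {l : ℝ} {x : H} :
    x ∈ eigenspace A l ↔ (μ - l) • R x = x := by
  rw [mem_eigenspace_iff]
  constructor
  · rintro ⟨hx, hAx⟩
    simpa only [hAx, ← sub_smul, map_smul] using hR.left_inv ⟨x, hx⟩
  · intro h
    have hx : x ∈ A.domain := h ▸ A.domain.smul_mem _ (hR.mem_domain x)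
    have hsub : (⟨x, hx⟩ : A.domain) = (μ - l) • ⟨R x, hR.mem_domain x⟩ := Subtype.ext h.symm
    refine ⟨hx, ?_⟩
    rw [hsub, A.map_smul, hR.apply_map]
    nth_rewrite 3 [← h]
    nth_rewrite 2 [← h]
    module

theorem sub_ne_zero_of_eigenspace_ne_bot (hR : IsResolventOf A μ R) {l : ℝ}
    (hl : eigenspace A l ≠ ⊥) : μ - l ≠ 0 := by
  intro h
  refine hl ((Submodule.eq_bot_iff _).2 fun x hx => ?_)
  simpa only [h, zero_smul, eq_comm] using hR.mem_eigenspace_iff_smul_eq.1 hx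

theorem eigenspace_eq_ker (hR : IsResolventOf A μ R) {l : ℝ} (hl : μ - l ≠ 0) :
    eigenspace A l = (R - (μ - l)⁻¹ • (1 : H →L[ℝ] H)).ker := by
  ext x
  rw [hR.mem_eigenspace_iff_smul_eq, ← eq_inv_smul_iff₀ hl, LinearMap.mem_ker]
  exact sub_eq_zero.symm

theorem apply_comm (hR : IsResolventOf A μ R) {g : H →L[ℝ] H →L[ℝ] ℝ}
    (hA : IsSelfAdjointFor g A) (x y : H) : g (R x) y = g x (R y) := by
  have hadj := (hA.adjoint_graph (R y) _).2 (A.mem_graph ⟨R y, hR.mem_domain y⟩)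
    ⟨R x, hR.mem_domain x⟩
  simp only [hR.apply_map, map_sub, map_smul, sub_apply, smul_apply] at hadj
  linarith

theorem sub_eq_smul_mul (hR : IsResolventOf A μ R) {ν : ℝ} {R' : H →L[ℝ] H}
    (hR' : IsResolventOf A ν R') : R - R' = (ν - μ) • (R * R') := by
  ext x
  have hinv : R (μ • R' x - A ⟨R' x, hR'.mem_domain x⟩) = R' x :=
    hR.left_inv ⟨R' x, hR'.mem_domain x⟩
  rw [hR'.apply_map, map_sub, map_sub, map_smul, map_smul] at hinv
  simp only [sub_apply, smul_apply, mul_apply_eq_comp]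
  nth_rewrite 1 [← hinv]
  module

theorem isUnit_sub_smul_one (hR : IsResolventOf A μ R) {t : ℝ} (ht : t ≠ 0)
    (hres : μ - t⁻¹ ∈ resolventSet A) : IsUnit (R - t • (1 : H →L[ℝ] H)) := by
  obtain ⟨R', hR'⟩ := hres
  have hmul : R * (1 + t⁻¹ • R') = R' := by
    have h := hR.sub_eq_smul_mul hR'
    rw [sub_sub_cancel_left, neg_smul] at h
    rw [mul_add, mul_one, mul_smul_comm, ← sub_neg_eq_add, ← h, sub_sub_cancel]
  have hmul' : (1 + t⁻¹ • R') * R = R' := by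
    have h := hR'.sub_eq_smul_mul hR
    rw [sub_sub_cancel] at h
    rw [add_mul, one_mul, smul_mul_assoc, ← h, add_sub_cancel]
  refine isUnit_iff_exists.2 ⟨-(t⁻¹ • (1 + t⁻¹ • R')), ?_, ?_⟩
  · rw [mul_neg, mul_smul_comm, sub_mul, hmul, smul_one_mul, smul_add, smul_inv_smul₀ ht,
      sub_add_cancel_right, smul_neg, inv_smul_smul₀ ht, neg_neg]
  · rw [neg_mul, smul_mul_assoc, mul_sub, hmul', mul_smul_one, smul_add, smul_inv_smul₀ ht,
      sub_add_cancel_right, smul_neg, inv_smul_smul₀ ht, neg_neg]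

theorem exists_isUnit_sub (hR : IsResolventOf A μ R) {l : ℝ} (hl : μ - l ≠ 0)
    (hacc : ¬ AccPt l (𝓟 (spectrum A))) :
    ∃ d > 0, ∀ s : ℝ, s ≠ 0 → |s| < d →
      IsUnit (R - (μ - l)⁻¹ • (1 : H →L[ℝ] H) - s • (1 : H →L[ℝ] H)) := by
  rw [accPt_iff_frequently_nhdsNE, not_frequently] at hacc
  set κ := (μ - l)⁻¹ with hκ
  have hκ0 : κ ≠ 0 := inv_ne_zero hl
  have hl_eq : μ - (κ + 0)⁻¹ = l := by simp [hκ]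
  have hcont : ContinuousAt (fun s : ℝ => μ - (κ + s)⁻¹) 0 :=
    continuousAt_const.sub (ContinuousAt.inv₀ (by fun_prop) (by simpa using hκ0))
  have hinj : ∀ s, μ - (κ + s)⁻¹ = l → s = 0 := fun s hs => by
    simpa using inv_injective (sub_right_injective (hs.trans hl_eq.symm))
  have hev : ∀ᶠ s : ℝ in 𝓝 0, κ + s ≠ 0 ∧
      (μ - (κ + s)⁻¹ ≠ l → μ - (κ + s)⁻¹ ∉ spectrum A) := by
    refine .and (ContinuousAt.eventually_ne (by fun_prop) (by simpa using hκ0)) ?_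
    rw [← hl_eq] at hacc
    simpa only [hl_eq, mem_compl_singleton_iff] using
      hcont.eventually (eventually_nhdsWithin_iff.1 hacc)
  obtain ⟨d, hd, hball⟩ := Metric.eventually_nhds_iff.1 hev
  refine ⟨d, hd, fun s hs hsd => ?_⟩
  obtain ⟨hne, hmem⟩ := hball (by simpa using hsd)
  rw [sub_sub, ← add_smul]
  exact hR.isUnit_sub_smul_one hne (not_not.1 (hmem (mt (hinj s) hs)))

end IsResolventOf

end Resolvent

section SymmetricOperators

variable {H : Type*} [NormedAddCommGroup H] [NormedSpace ℝ H] {g : H →L[ℝ] H →L[ℝ] ℝ}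
  {S : H →L[ℝ] H}

theorem isUnit_mul_self_sub_smul_one {S : H →L[ℝ] H} {s : ℝ} (hs : 0 ≤ s)
    (hsub : IsUnit (S - √s • (1 : H →L[ℝ] H))) (hadd : IsUnit (S - (-√s) • (1 : H →L[ℝ] H))) :
    IsUnit (S * S - s • (1 : H →L[ℝ] H)) := by
  have hfactor : S * S - s • (1 : H →L[ℝ] H) =
      (S - √s • (1 : H →L[ℝ] H)) * (S - (-√s) • (1 : H →L[ℝ] H)) := by
    nth_rewrite 1 [← Real.mul_self_sqrt hs]
    simp only [sub_mul, mul_sub, smul_mul_assoc, mul_smul_comm, one_mul, mul_one]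
    module
  exact hfactor ▸ hsub.mul hadd

namespace IsEquivInner

theorem apply_self_nonneg (hg : IsEquivInner g) (x : H) : 0 ≤ g x x := by
  obtain ⟨c, hc, hgc⟩ := hg.coercive
  exact le_trans (by positivity) (hgc x)

theorem exists_apply_map_map_le (hg : IsEquivInner g) (S T : H →L[ℝ] H) :
    ∃ C > 0, ∀ x, g (S x) (T x) ≤ C * g x x := by
  obtain ⟨c, hc, hgc⟩ := hg.coercive
  refine ⟨(‖g‖ * ‖S‖ * ‖T‖ + 1) / c, by positivity, fun x => ?_⟩
  calc g (S x) (T x) ≤ ‖g‖ * ‖S x‖ * ‖T x‖ := (le_abs_self _).trans (g.le_opNorm₂ _ _)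
    _ ≤ ‖g‖ * (‖S‖ * ‖x‖) * (‖T‖ * ‖x‖) := by gcongr <;> exact ContinuousLinearMap.le_opNorm _ _
    _ ≤ (‖g‖ * ‖S‖ * ‖T‖ + 1) * ‖x‖ ^ 2 := by nlinarith [sq_nonneg ‖x‖]
    _ = (‖g‖ * ‖S‖ * ‖T‖ + 1) / c * (c * ‖x‖ ^ 2) := by field_simp
    _ ≤ (‖g‖ * ‖S‖ * ‖T‖ + 1) / c * g x x := by gcongr; exact hgc x

theorem exists_mul_le_of_isUnit (hg : IsEquivInner g) (hS : ∀ x y, g (S x) y = g x (S y))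
    (hpos : ∀ x, 0 ≤ g (S x) x) (hunit : IsUnit S) : ∃ c > 0, ∀ x, c * g x x ≤ g (S x) x := by
  obtain ⟨C, hC, hSC⟩ := hg.exists_apply_map_map_le S 1
  obtain ⟨T, -, hTS⟩ := isUnit_iff_exists.1 hunit
  obtain ⟨D, hD, hTD⟩ := hg.exists_apply_map_map_le T T
  refine ⟨(C * D)⁻¹, by positivity, fun x => ?_⟩
  have hxD : g x x ≤ D * g (S x) (S x) := by
    have hx : T (S x) = x := DFunLike.congr_fun hTS x
    simpa only [hx] using hTD (S x)
  -- Cauchy–Schwarz for the form `(x, y) ↦ g (S x) y`, applied to `x` and `S x`.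
  have hxC : g (S x) (S x) ≤ C * g (S x) x := by
    have hsq : g (S x) (S x) ^ 2 ≤ g (S x) x * g (S (S x)) (S x) :=
      LinearMap.BilinForm.apply_sq_le_of_symm (g ∘L S).toBilinForm hpos
        ⟨fun x y => by simpa [hg.symm (S y)] using hS x y⟩ x (S x)
    have hSx : g (S (S x)) (S x) ≤ C * g (S x) (S x) := hSC (S x)
    rcases (hg.apply_self_nonneg (S x)).eq_or_lt with hzero | hlt
    · nlinarith [hpos x]
    · refine le_of_mul_le_mul_right ?_ hlt
      nlinarith [mul_le_mul_of_nonneg_left hSx (hpos x)]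
  rw [inv_mul_le_iff₀ (by positivity)]
  nlinarith

theorem mul_le_of_forall_isUnit (hg : IsEquivInner g) (hS : ∀ x y, g (S x) y = g x (S y))
    {a b : ℝ} (hab : a ≤ b) (ha : ∀ x, a * g x x ≤ g (S x) x)
    (hunit : ∀ c ∈ Ico a b, IsUnit (S - c • (1 : H →L[ℝ] H))) (x : H) :
    b * g x x ≤ g (S x) x := by
  let s : Set ℝ := {c | ∀ x, c * g x x ≤ g (S x) x}
  have hs : IsClosed s := by
    simp only [s, ofPred_forall]
    exact isClosed_iInter fun x => isClosed_le (by fun_prop) (by fun_prop)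
  refine (hs.inter isClosed_Icc).mem_of_ge_of_forall_exists_gt ha hab (fun c hc => ?_) x
  obtain ⟨hcs, hc⟩ := hc
  have hsub : ∀ x, g ((S - c • (1 : H →L[ℝ] H)) x) x = g (S x) x - c * g x x := fun x => by simp
  obtain ⟨ε, hε, hcε⟩ := hg.exists_mul_le_of_isUnit (S := S - c • (1 : H →L[ℝ] H))
    (fun x y => by simp [hS]) (fun x => by linarith [hsub x, hcs x]) (hunit c hc)
  refine ⟨min (c + ε) b, fun x => ?_, lt_min (by linarith) hc.2, min_le_right _ _⟩
  have hxx := hg.apply_self_nonneg x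
  calc min (c + ε) b * g x x ≤ (c + ε) * g x x := by gcongr; exact min_le_left _ _
    _ ≤ g (S x) x := by linarith [hsub x, hcε x]

theorem sq_mul_apply_map_le (hg : IsEquivInner g) (hS : ∀ x y, g (S x) y = g x (S y)) {d : ℝ}
    (hd : 0 < d) (hunit : ∀ s : ℝ, s ≠ 0 → |s| < d → IsUnit (S - s • (1 : H →L[ℝ] H))) (x : H) :
    d ^ 2 * g (S x) (S x) ≤ g (S (S x)) (S (S x)) := by
  -- The spectrum of `S ^ 2` avoids `(0, d ^ 2)`, so that of `N ^ 2` avoids `[0, (d ^ 2 / 2) ^ 2)`.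
  let N : H →L[ℝ] H := S * S - (d ^ 2 / 2) • 1
  have hNx : ∀ x, N x = S (S x) - (d ^ 2 / 2) • x := fun x => rfl
  have hN : ∀ x y, g (N x) y = g x (N y) := fun x y => by simp [hNx, hS]
  have hSunit : ∀ s, 0 < s → s < d ^ 2 → IsUnit (S * S - s • (1 : H →L[ℝ] H)) := by
    intro s hs hsd
    have hsqrt : 0 < √s := Real.sqrt_pos.2 hs
    have hlt : √s < d := (Real.sqrt_lt' hd).2 hsd
    exact isUnit_mul_self_sub_smul_one hs.le (hunit _ hsqrt.ne' (by rwa [abs_of_pos hsqrt]))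
      (hunit _ (neg_ne_zero.2 hsqrt.ne') (by rwa [abs_neg, abs_of_pos hsqrt]))
  have hNunit : ∀ c ∈ Ico 0 ((d ^ 2 / 2) ^ 2), IsUnit (N * N - c • (1 : H →L[ℝ] H)) := by
    intro c hc
    have hlt : √c < d ^ 2 / 2 := (Real.sqrt_lt' (by positivity)).2 hc.2
    have hsqrt := Real.sqrt_nonneg c
    have hshift : ∀ s, N - s • (1 : H →L[ℝ] H) = S * S - (d ^ 2 / 2 + s) • 1 := fun s => by
      simp only [N, add_smul, sub_sub]
    refine isUnit_mul_self_sub_smul_one hc.1 ?_ ?_ <;> rw [hshift] <;>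
      exact hSunit _ (by linarith) (by linarith)
  have hNsq := hg.mul_le_of_forall_isUnit (S := N * N) (fun x y => by simp [hN])
    (by positivity) (fun x => by simpa [hN] using hg.apply_self_nonneg (N x)) hNunit x
  have hexpand : g ((N * N) x) x =
      g (S (S x)) (S (S x)) - d ^ 2 * g (S x) (S x) + (d ^ 2 / 2) ^ 2 * g x x := by
    have hcross : g (S (S x)) x = g (S x) (S x) := hS (S x) x
    rw [mul_apply_eq_comp, hN, hNx]
    simp only [map_sub, map_smul, sub_apply, smul_apply, smul_eq_mul, hg.symm x (S (S x)), hcross]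
    ring
  linarith

theorem exists_norm_map_le (hg : IsEquivInner g) (hS : ∀ x y, g (S x) y = g x (S y)) {d : ℝ}
    (hd : 0 < d) (hunit : ∀ s : ℝ, s ≠ 0 → |s| < d → IsUnit (S - s • (1 : H →L[ℝ] H))) :
    ∃ C > 0, ∀ x, ‖S x‖ ≤ C * ‖S (S x)‖ := by
  obtain ⟨c, hc, hgc⟩ := hg.coercive
  refine ⟨√((‖g‖ + 1) / (c * d ^ 2)), by positivity, fun x => ?_⟩
  have hsq : c * d ^ 2 * ‖S x‖ ^ 2 ≤ (‖g‖ + 1) * ‖S (S x)‖ ^ 2 :=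
    calc c * d ^ 2 * ‖S x‖ ^ 2 = d ^ 2 * (c * ‖S x‖ ^ 2) := by ring
      _ ≤ d ^ 2 * g (S x) (S x) := by gcongr; exact hgc _
      _ ≤ g (S (S x)) (S (S x)) := hg.sq_mul_apply_map_le hS hd hunit x
      _ ≤ ‖g‖ * ‖S (S x)‖ * ‖S (S x)‖ := (le_abs_self _).trans (g.le_opNorm₂ _ _)
      _ ≤ (‖g‖ + 1) * ‖S (S x)‖ ^ 2 := by nlinarith [sq_nonneg ‖S (S x)‖]
  refine le_of_sq_le_sq ?_ (by positivity)
  rw [mul_pow, Real.sq_sqrt (by positivity), div_mul_eq_mul_div, le_div_iff₀ (by positivity)]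
  linarith

end IsEquivInner

section Perturbation

theorem exists_norm_le_of_norm_map_le [CompleteSpace H] {C d : ℝ} (hC : 0 < C)
    (hSC : ∀ x, ‖S x‖ ≤ C * ‖S (S x)‖) (hd : 0 < d)
    (hunit : ∀ s : ℝ, s ≠ 0 → |s| < d → IsUnit (S - s • (1 : H →L[ℝ] H))) (x : H) :
    ∃ r, S r = S x ∧ ‖r‖ ≤ (C + 1) * ‖S x‖ := by
  let f : NormedAddGroupHom H H := S.toLinearMap.toAddMonoidHom.mkNormedAddGroupHom ‖S‖ S.le_opNorm
  let K : AddSubgroup H := (S * S : H →L[ℝ] H).toLinearMap.toAddMonoidHom.range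
  have hK : f.SurjectiveOnWith K C := by
    rintro _ ⟨z, rfl⟩
    exact ⟨S z, rfl, hSC z⟩
  refine controlled_closure_of_complete hC one_pos hK (S x) ?_
  -- `S x = S (S z) - s • S z` for `z = (S - s)⁻¹ x`, and `S z` stays bounded as `s → 0`.
  refine Metric.mem_closure_iff.2 fun ε hε => ?_
  obtain ⟨s, hs, hsd⟩ : ∃ s > 0, s < min d (min (1 / (2 * C)) (ε / (2 * C * (‖S x‖ + 1)))) :=
    exists_between (by positivity)
  simp only [lt_min_iff] at hsd
  obtain ⟨T, hT, -⟩ := isUnit_iff_exists.1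
    (hunit s hs.ne' (by rw [abs_of_pos hs]; exact hsd.1))
  have hTx : S (T x) - s • T x = x := DFunLike.congr_fun hT x
  have hSx : S (S (T x)) - S x = s • S (T x) := by
    nth_rewrite 2 [← hTx]
    simp only [map_sub, map_smul, sub_sub_cancel]
  have hbound : ‖S (T x)‖ ≤ 2 * C * ‖S x‖ := by
    have := hSC (T x)
    have htri : ‖S (S (T x))‖ ≤ ‖S x‖ + s * ‖S (T x)‖ := by
      rw [← sub_add_cancel (S (S (T x))) (S x), hSx, add_comm]
      exact (norm_add_le _ _).trans_eq (by rw [norm_smul, Real.norm_of_nonneg hs.le])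
    have hsC : C * s ≤ 1 / 2 := by
      have := (lt_div_iff₀ (by positivity)).1 hsd.2.1
      linarith
    nlinarith [norm_nonneg (S (T x))]
  refine ⟨S (S (T x)), ⟨T x, rfl⟩, ?_⟩
  rw [dist_comm, dist_eq_norm, hSx, norm_smul, Real.norm_of_nonneg hs.le]
  calc s * ‖S (T x)‖ ≤ s * (2 * C * (‖S x‖ + 1)) := by
        gcongr
        exact hbound.trans (by gcongr; linarith)
    _ < ε := (lt_div_iff₀ (by positivity)).1 hsd.2.2

theorem IsEquivInner.exists_proj_ker [CompleteSpace H] (hg : IsEquivInner g)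
    (hS : ∀ x y, g (S x) y = g x (S y)) {d : ℝ} (hd : 0 < d)
    (hunit : ∀ s : ℝ, s ≠ 0 → |s| < d → IsUnit (S - s • (1 : H →L[ℝ] H)))
    [FiniteDimensional ℝ S.ker] :
    ∃ (P : H →L[ℝ] S.ker) (C : ℝ), 0 ≤ C ∧ ∀ x, ‖x - P x‖ ≤ C * ‖S x‖ := by
  obtain ⟨C, hC, hSC⟩ := hg.exists_norm_map_le hS hd hunit
  obtain ⟨P, hP⟩ := Submodule.ClosedComplemented.of_finiteDimensional S.ker
  refine ⟨P, (1 + ‖P‖) * (C + 1), by positivity, fun x => ?_⟩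
  obtain ⟨r, hr, hrx⟩ := exists_norm_le_of_norm_map_le hC hSC hd hunit x
  have hPxr : (P (x - r) : H) = x - r :=
    congrArg Subtype.val (hP ⟨x - r, by simp [hr]⟩)
  have hsub : x - P x = r - P r := by
    rw [map_sub, Submodule.coe_sub] at hPxr
    rw [sub_eq_sub_iff_sub_eq_sub, hPxr]
  calc ‖x - P x‖ ≤ ‖r‖ + ‖P‖ * ‖r‖ :=
        hsub ▸ (norm_sub_le _ _).trans (by gcongr; exact P.le_opNorm r)
    _ ≤ (1 + ‖P‖) * (C + 1) * ‖S x‖ := by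
      rw [← one_add_mul, mul_assoc]
      gcongr

theorem exists_mem_ker_near [FiniteDimensional ℝ S.ker] {P : H →L[ℝ] S.ker} {C : ℝ}
    (hC : 0 ≤ C) (hPC : ∀ x, ‖x - P x‖ ≤ C * ‖S x‖) {S' : H →L[ℝ] H} (hS' : C * ‖S' - S‖ ≤ 1 / 2)
    (hrank : finrank ℝ S'.ker = finrank ℝ S.ker) {v : H} (hv : S v = 0) :
    ∃ x, S' x = 0 ∧ ‖x - v‖ ≤ 2 * C * ‖S' - S‖ * ‖v‖ := by
  have hnear : ∀ x, S' x = 0 → ‖x - P x‖ ≤ C * ‖S' - S‖ * ‖x‖ := fun x hx => by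
    have hSx : S x = -(S' - S) x := by simp [hx]
    calc ‖x - P x‖ ≤ C * ‖S x‖ := hPC x
      _ ≤ C * (‖S' - S‖ * ‖x‖) := by gcongr; rw [hSx, norm_neg]; exact (S' - S).le_opNorm x
      _ = C * ‖S' - S‖ * ‖x‖ := by ring
  let p : S'.ker →ₗ[ℝ] S.ker := P.toLinearMap.domRestrict S'.ker
  have hinj : Function.Injective p := by
    refine (injective_iff_map_eq_zero p).2 fun x hx => ?_
    have hPx : P (x : H) = 0 := hx
    have hx' := hnear x x.2
    rw [hPx, Submodule.coe_zero, sub_zero] at hx'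
    refine Subtype.ext (norm_le_zero_iff.1 ?_)
    nlinarith [norm_nonneg (x : H)]
  have : FiniteDimensional ℝ S'.ker := FiniteDimensional.of_injective p hinj
  obtain ⟨x, hx⟩ :=
    (LinearMap.injective_iff_surjective_of_finrank_eq_finrank hrank).1 hinj ⟨v, hv⟩
  have hPx : (P (x : H) : H) = v := congrArg Subtype.val hx
  have hxv := hnear x x.2
  rw [hPx] at hxv
  refine ⟨x, x.2, ?_⟩
  have hxnorm : ‖(x : H)‖ ≤ 2 * ‖v‖ := by
    have := norm_le_norm_add_norm_sub' (x : H) v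
    nlinarith [norm_nonneg (x : H)]
  calc ‖(x : H) - v‖ ≤ C * ‖S' - S‖ * ‖(x : H)‖ := hxv
    _ ≤ C * ‖S' - S‖ * (2 * ‖v‖) := by gcongr
    _ = 2 * C * ‖S' - S‖ * ‖v‖ := by ring

theorem IsEquivInner.isBigO_apply_sub_of_finrank_ker_eq [CompleteSpace H] (hg : IsEquivInner g)
    (hS : ∀ x y, g (S x) y = g x (S y)) {d : ℝ} (hd : 0 < d)
    (hunit : ∀ s : ℝ, s ≠ 0 → |s| < d → IsUnit (S - s • (1 : H →L[ℝ] H)))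
    [FiniteDimensional ℝ S.ker] {v w : H} (hv : S v = 0) (hw : S w = 0) :
    (fun S' => g ((S' - S) v) w) =O[𝓝[{S' | finrank ℝ S'.ker = finrank ℝ S.ker}] S]
      fun S' => ‖S' - S‖ ^ 2 := by
  obtain ⟨P, C, hC, hPC⟩ := hg.exists_proj_ker hS hd hunit
  have hnear : ∀ᶠ S' : H →L[ℝ] H in 𝓝 S, C * ‖S' - S‖ ≤ 1 / 2 := by
    have hcont : ContinuousAt (fun S' => C * ‖S' - S‖) S := by fun_prop
    exact (hcont.eventually_lt_const (by simp)).mono fun _ => le_of_lt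
  refine .of_bound (‖g‖ * (2 * C * ‖v‖) * ‖w‖) ?_
  filter_upwards [nhdsWithin_le_nhds hnear, self_mem_nhdsWithin] with S' hS' hrank
  obtain ⟨x, hx, hxv⟩ := exists_mem_ker_near hC hPC hS' hrank hv
  have horth : g ((S' - S) x) w = 0 := by
    simp [hx, hS, hw]
  have hsub : g ((S' - S) (x - v)) w = g ((S' - S) x) w - g ((S' - S) v) w :=
    (g.flip w ∘L (S' - S)).map_sub x v
  rw [horth, zero_sub] at hsub
  rw [← norm_neg, ← hsub, norm_pow, norm_norm]
  calc ‖g ((S' - S) (x - v)) w‖ ≤ ‖g‖ * ‖(S' - S) (x - v)‖ * ‖w‖ := g.le_opNorm₂ _ _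
    _ ≤ ‖g‖ * (‖S' - S‖ * (2 * C * ‖S' - S‖ * ‖v‖)) * ‖w‖ := by
      gcongr
      exact (S' - S).le_opNorm_of_le hxv
    _ = ‖g‖ * (2 * C * ‖v‖) * ‖w‖ * ‖S' - S‖ ^ 2 := by ring

/-- The trace-free part of the compression of the operator `T` to the span of `v₁` and `v₂`, encoded
as the pair `(⟨T v₁, v₁⟩ - ⟨T v₂, v₂⟩, ⟨T v₁, v₂⟩)`. -/
def traceFreeEntries (g : H →L[ℝ] H →L[ℝ] ℝ) (v₁ v₂ : H) : (H →L[ℝ] H) →L[ℝ] Fin 2 → ℝ :=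
  let entry (v w : H) : (H →L[ℝ] H) →L[ℝ] ℝ := g.flip w ∘L ContinuousLinearMap.apply ℝ H v
  ContinuousLinearMap.pi ![entry v₁ v₁ - entry v₂ v₂, entry v₁ v₂]

theorem traceFreeEntries_apply (v₁ v₂ : H) (T : H →L[ℝ] H) :
    traceFreeEntries g v₁ v₂ T = ![g (T v₁) v₁ - g (T v₂) v₂, g (T v₁) v₂] := by
  ext i
  fin_cases i <;> rfl

theorem traceFreeEntries_sub_smul_one {v₁ v₂ : H} (h₁₁ : g v₁ v₁ = 1) (h₂₂ : g v₂ v₂ = 1)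
    (h₁₂ : g v₁ v₂ = 0) (T : H →L[ℝ] H) (δ : ℝ) :
    traceFreeEntries g v₁ v₂ (T - δ • (1 : H →L[ℝ] H)) = traceFreeEntries g v₁ v₂ T := by
  simp [traceFreeEntries_apply, h₁₁, h₂₂, h₁₂]

theorem isBigO_sub_smul_one_of_isLittleO {α : Type*} {l : Filter α} {D : α → H →L[ℝ] H}
    {δ : α → ℝ} {v : H} (hv : g v v = 1)
    (h : (fun p => g ((D p - δ p • (1 : H →L[ℝ] H)) v) v) =o[l]
      fun p => D p - δ p • (1 : H →L[ℝ] H)) :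
    (fun p => D p - δ p • (1 : H →L[ℝ] H)) =O[l] D := by
  let Ψ : (H →L[ℝ] H) →L[ℝ] H →L[ℝ] H :=
    ContinuousLinearMap.toSpanSingleton ℝ 1 ∘L g.flip v ∘L ContinuousLinearMap.apply ℝ H v
  have hΨ : ∀ T, Ψ T = g (T v) v • (1 : H →L[ℝ] H) := fun T => rfl
  have hsmall : (fun p => Ψ (D p - δ p • (1 : H →L[ℝ] H))) =o[l]
      fun p => D p - δ p • (1 : H →L[ℝ] H) :=
    ((ContinuousLinearMap.toSpanSingleton ℝ (1 : H →L[ℝ] H)).isBigO_comp _ _).trans_isLittleO h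
  -- `T ↦ T - Ψ T` annihilates the scalar operators.
  have hcancel : ∀ p, D p - δ p • (1 : H →L[ℝ] H) - Ψ (D p - δ p • (1 : H →L[ℝ] H)) =
      (1 - Ψ) (D p) := fun p => by
    rw [map_sub, map_smul, hΨ 1, one_apply_eq_self, hv, sub_apply, one_apply_eq_self]
    module
  refine hsmall.right_isBigO_sub.trans ?_
  simp only [hcancel]
  exact (1 - Ψ).isBigO_comp D l

theorem IsEquivInner.isBigO_traceFreeEntries_of_finrank_ker_eq [CompleteSpace H]
    (hg : IsEquivInner g) {T : H →L[ℝ] H} {κ d : ℝ} (hT : ∀ x y, g (T x) y = g x (T y))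
    (hd : 0 < d)
    (hunit : ∀ s : ℝ, s ≠ 0 → |s| < d → IsUnit (T - κ • (1 : H →L[ℝ] H) - s • (1 : H →L[ℝ] H)))
    [FiniteDimensional ℝ (T - κ • (1 : H →L[ℝ] H)).ker] {v₁ v₂ : H} (hv₁ : T v₁ = κ • v₁)
    (hv₂ : T v₂ = κ • v₂) (h₁₁ : g v₁ v₁ = 1) (h₂₂ : g v₂ v₂ = 1) (h₁₂ : g v₁ v₂ = 0) :
    (fun p : (H →L[ℝ] H) × ℝ => traceFreeEntries g v₁ v₂ (p.1 - T))
      =O[𝓝[{p | finrank ℝ (p.1 - p.2 • (1 : H →L[ℝ] H)).ker =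
        finrank ℝ (T - κ • (1 : H →L[ℝ] H)).ker}] (T, κ)] fun p => ‖p.1 - T‖ ^ 2 := by
  set S : H →L[ℝ] H := T - κ • (1 : H →L[ℝ] H) with hS
  set l := 𝓝[{p : (H →L[ℝ] H) × ℝ | finrank ℝ (p.1 - p.2 • (1 : H →L[ℝ] H)).ker =
    finrank ℝ S.ker}] (T, κ)
  let S' : (H →L[ℝ] H) × ℝ → H →L[ℝ] H := fun p => p.1 - p.2 • 1
  have hS'cont : Tendsto S' (𝓝 (T, κ)) (𝓝 S) := by
    have : Continuous S' := by fun_prop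
    exact this.tendsto _
  have hS' : Tendsto S' l (𝓝[{S' | finrank ℝ S'.ker = finrank ℝ S.ker}] S) :=
    tendsto_nhdsWithin_iff.2 ⟨hS'cont.mono_left nhdsWithin_le_nhds, self_mem_nhdsWithin⟩
  have hentry : ∀ {v w : H}, T v = κ • v → T w = κ • w →
      (fun p => g ((S' p - S) v) w) =O[l] fun p => ‖S' p - S‖ ^ 2 := fun hv hw =>
    (hg.isBigO_apply_sub_of_finrank_ker_eq (fun x y => by simp [hS, hT]) hd hunit
      (by simp [hS, hv]) (by simp [hS, hw])).comp_tendsto hS'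
  have hdiff : ∀ p, S' p - S = (p.1 - T) - (p.2 - κ) • (1 : H →L[ℝ] H) := fun p => by
    simp only [S', hS]
    module
  have hsmall : (fun p => g ((S' p - S) v₁) v₁) =o[l] fun p => S' p - S :=
    (hentry hv₁ hv₁).trans_isLittleO <| (Asymptotics.isLittleO_norm_pow_id one_lt_two).comp_tendsto
      (tendsto_sub_nhds_zero_iff.2 (hS'cont.mono_left nhdsWithin_le_nhds))
  have hS'T : (fun p => S' p - S) =O[l] fun p => p.1 - T := by
    simp only [hdiff] at hsmall ⊢
    exact isBigO_sub_smul_one_of_isLittleO h₁₁ hsmall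
  have hpair : (fun p => traceFreeEntries g v₁ v₂ (S' p - S)) =O[l] fun p => ‖S' p - S‖ ^ 2 := by
    refine Asymptotics.isBigO_pi.2 fun i => ?_
    simp only [traceFreeEntries_apply]
    fin_cases i
    · exact (hentry hv₁ hv₁).sub (hentry hv₂ hv₂)
    · exact hentry hv₁ hv₂
  refine (hpair.trans (hS'T.norm_norm.pow 2)).congr_left fun p => ?_
  rw [hdiff, traceFreeEntries_sub_smul_one h₁₁ h₂₂ h₁₂]

theorem IsEquivInner.isBigO_traceFreeEntries_of_finrank_eigenspace_eq [CompleteSpace H]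
    (hg : IsEquivInner g) {A : H →ₗ.[ℝ] H} (hA : IsSelfAdjointFor g A) {l : ℝ}
    [FiniteDimensional ℝ (eigenspace A l)] (hacc : ¬ AccPt l (𝓟 (spectrum A))) {μ : ℝ}
    {R : H →L[ℝ] H} (hR : IsResolventOf A μ R) {v₁ v₂ : H} (hv₁ : v₁ ∈ eigenspace A l)
    (hv₂ : v₂ ∈ eigenspace A l) (h₁₁ : g v₁ v₁ = 1) (h₂₂ : g v₂ v₂ = 1) (h₁₂ : g v₁ v₂ = 0) :
    (fun p : (H →L[ℝ] H) × ℝ => traceFreeEntries g v₁ v₂ (p.1 - R))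
      =O[𝓝[{p | ∃ A', IsResolventOf A' μ p.1 ∧
        finrank ℝ (eigenspace A' p.2) = finrank ℝ (eigenspace A l)}] (R, l)]
      fun p => ‖p.1 - R‖ ^ 2 := by
  have hl : μ - l ≠ 0 := hR.sub_ne_zero_of_eigenspace_ne_bot
    ((Submodule.ne_bot_iff _).2 ⟨v₁, hv₁, by rintro rfl; simp at h₁₁⟩)
  have hker := hR.eigenspace_eq_ker hl
  obtain ⟨d, hd, hunit⟩ := hR.exists_isUnit_sub hl hacc
  have : FiniteDimensional ℝ (R - (μ - l)⁻¹ • (1 : H →L[ℝ] H)).ker := hker ▸ ‹_›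
  have heigen : ∀ {v}, v ∈ eigenspace A l → R v = (μ - l)⁻¹ • v := fun hv =>
    (eq_inv_smul_iff₀ hl).2 (hR.mem_eigenspace_iff_smul_eq.1 hv)
  have hcont : ContinuousAt (fun p : (H →L[ℝ] H) × ℝ => μ - p.2) (R, l) := by fun_prop
  refine (hg.isBigO_traceFreeEntries_of_finrank_ker_eq (hR.apply_comm hA) hd hunit (heigen hv₁)
    (heigen hv₂) h₁₁ h₂₂ h₁₂).comp_tendsto
    (k := fun p : (H →L[ℝ] H) × ℝ => (p.1, (μ - p.2)⁻¹))
    (tendsto_nhdsWithin_iff.2 ⟨?_, ?_⟩)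
  · exact (continuousAt_fst.prodMk (hcont.inv₀ hl)).mono_left nhdsWithin_le_nhds
  · filter_upwards [self_mem_nhdsWithin, nhdsWithin_le_nhds (hcont.eventually_ne hl)] with p hp hpl
    obtain ⟨A', hR', hrank⟩ := hp
    rwa [hR'.eigenspace_eq_ker hpl, hker] at hrank

end Perturbation

end SymmetricOperators

section Family

theorem mem_spectrum_of_eigenspace_ne_bot {H : Type*} [NormedAddCommGroup H] [NormedSpace ℝ H]
    {A : H →ₗ.[ℝ] H} {l : ℝ} (hl : eigenspace A l ≠ ⊥) : l ∈ spectrum A :=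
  fun ⟨_, hR⟩ => hR.sub_ne_zero_of_eigenspace_ne_bot hl (sub_self l)

theorem surjective_pi_of_linearIndependent {ι K M : Type*} [Finite ι] [Field K] [AddCommGroup M]
    [Module K M] {f : ι → M →ₗ[K] K} (hf : LinearIndependent K f) :
    Function.Surjective (LinearMap.pi f) := by
  have hcoe : LinearIndependent K fun i x => f i x :=
    hf.map' (LinearMap.ltoFun K M K K) (LinearMap.ker_eq_bot.2 DFunLike.coe_injective)
  rw [← LinearMap.range_eq_top, ← span_flip_eq_top_iff_linearIndependent.2 hcoe]
  exact (Submodule.span_eq (LinearMap.range (LinearMap.pi f))).symm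

/-- The parameters `p` for which `A p` has an eigenvalue of multiplicity exactly `m` in `I`. -/
def multiplicityStratum {P H : Type*} [NormedAddCommGroup H] [NormedSpace ℝ H]
    (A : P → H →ₗ.[ℝ] H) (m : ℕ) (I : Set ℝ) : Set P :=
  {p | ∃ l ∈ I, finrank ℝ (eigenspace (A p) l) = m}

theorem multiplicityStratum_mono {P H : Type*} [NormedAddCommGroup H] [NormedSpace ℝ H]
    (A : P → H →ₗ.[ℝ] H) (m : ℕ) {I J : Set ℝ} (hIJ : I ⊆ J) :
    multiplicityStratum A m I ⊆ multiplicityStratum A m J :=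
  fun _ ⟨l, hl, hm⟩ => ⟨l, hIJ hl, hm⟩

variable {E H : Type*} [NormedAddCommGroup E] [NormedSpace ℝ E] [NormedAddCommGroup H]
  [NormedSpace ℝ H]

theorem exists_hasTangentCodim_multiplicityStratum [CompleteSpace H] {g : H →L[ℝ] H →L[ℝ] ℝ}
    (hg : IsEquivInner g) {A : E → H →ₗ.[ℝ] H} {y : E} (hA : IsSelfAdjointFor g (A y))
    (hspec : HasDiscreteSpectrum (A y)) {μ : ℝ} (hμ : ∀ᶠ y' in 𝓝 y, μ ∈ resolventSet (A y'))
    (hdiff : DifferentiableAt ℝ (fun y' => resolvent (A y') μ) y) {l : ℝ} {v₁ v₂ : H}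
    (hv₁ : v₁ ∈ eigenspace (A y) l) (hv₂ : v₂ ∈ eigenspace (A y) l) (h₁₁ : g v₁ v₁ = 1)
    (h₂₂ : g v₂ v₂ = 1) (h₁₂ : g v₁ v₂ = 0)
    (hsurj : Function.Surjective
      (traceFreeEntries g v₁ v₂ ∘L fderiv ℝ (fun y' => resolvent (A y') μ) y)) :
    ∃ I ∈ 𝓝 l, HasTangentCodim (multiplicityStratum A (finrank ℝ (eigenspace (A y) l)) I) y 2 := by
  set R : E → H →L[ℝ] H := fun y' => resolvent (A y') μ
  have hl : l ∈ spectrum (A y) := mem_spectrum_of_eigenspace_ne_bot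
    ((Submodule.ne_bot_iff _).2 ⟨v₁, hv₁, by rintro rfl; simp at h₁₁⟩)
  have := hspec.finite_mult l hl
  obtain ⟨C, hC⟩ := (hg.isBigO_traceFreeEntries_of_finrank_eigenspace_eq hA (hspec.no_accPt l)
    (isResolventOf_resolvent hμ.self_of_nhds) hv₁ hv₂ h₁₁ h₂₂ h₁₂).bound
  rw [eventually_nhdsWithin_iff, nhds_prod_eq] at hC
  obtain ⟨U, hU, I, hI, hbound⟩ := eventually_prod_iff.1 hC
  refine ⟨{l' | I l'}, hI, _, hsurj, ?_⟩
  set W := multiplicityStratum A (finrank ℝ (eigenspace (A y) l)) {l' | I l'}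
  have hquad : (fun y' => traceFreeEntries g v₁ v₂ (R y' - R y)) =O[𝓝[W] y]
      fun y' => ‖R y' - R y‖ ^ 2 := by
    refine .of_bound C ?_
    filter_upwards [nhdsWithin_le_nhds hμ, nhdsWithin_le_nhds (hdiff.continuousAt.eventually hU),
      self_mem_nhdsWithin] with y' hμ' hy' ⟨l', hl', hrank⟩
    exact hbound hy' hl' ⟨A y', isResolventOf_resolvent hμ', hrank⟩
  have hsq : (fun y' => ‖R y' - R y‖ ^ 2) =o[𝓝[W] y] fun y' => y' - y :=
    ((hdiff.hasFDerivAt.isBigO_sub.norm_norm.pow 2).trans_isLittleO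
      (Asymptotics.isLittleO_pow_sub_sub y one_lt_two)).mono nhdsWithin_le_nhds
  have hlin : (fun y' => traceFreeEntries g v₁ v₂ (R y' - R y - fderiv ℝ R y (y' - y)))
      =o[𝓝[W] y] fun y' => y' - y :=
    ((traceFreeEntries g v₁ v₂).isBigO_comp _ _).trans_isLittleO
      (hdiff.hasFDerivAt.isLittleO.mono nhdsWithin_le_nhds)
  refine ((hquad.trans_isLittleO hsq).sub hlin).congr_left fun y' => ?_
  rw [← map_sub, sub_sub_cancel]
  rfl

variable {X : Type*} [TopologicalSpace X]

theorem separableSpace_of_chart [TopologicalSpace.SeparableSpace X]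
    (φ : OpenPartialHomeomorph X E) (hφ : φ.target.Nonempty) :
    TopologicalSpace.SeparableSpace E := by
  obtain ⟨s, hsc, hs⟩ := TopologicalSpace.exists_countable_dense X
  have hsep : TopologicalSpace.IsSeparable φ.target := by
    refine ⟨φ '' (φ.source ∩ s), (hsc.mono inter_subset_right).image φ, fun y hy => ?_⟩
    have hmem : φ.symm y ∈ closure (φ.source ∩ s) :=
      hs.open_subset_closure_inter φ.open_source (φ.map_target hy)
    have himage := (φ.continuousAt (φ.map_target hy)).continuousWithinAt.mem_closure_image hmem
    rwa [φ.right_inv hy] at himage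
  have hspan : Submodule.span ℝ φ.target = ⊤ :=
    Submodule.eq_top_of_nonempty_interior' _
      (hφ.mono (interior_maximal Submodule.subset_span φ.open_target))
  rw [← TopologicalSpace.isSeparable_univ_iff, ← Submodule.top_coe (R := ℝ), ← hspan]
  exact hsep.span

variable [ChartedSpace E X] {φ : OpenPartialHomeomorph X E}

theorem exists_fderiv_comp_symm_eq {F : Type*} [NormedAddCommGroup F] [NormedSpace ℝ F] {f : X → F}
    (hφ : φ ∈ IsManifold.maximalAtlas 𝓘(ℝ, E) 1 X) {y : E} (hy : y ∈ φ.target)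
    (hf : MDifferentiableAt 𝓘(ℝ, E) 𝓘(ℝ, F) f (φ.symm y))
    (ξ : TangentSpace 𝓘(ℝ, E) (φ.symm y)) :
    ∃ h, fderiv ℝ (fun y' => f (φ.symm y')) y h = mfderiv 𝓘(ℝ, E) 𝓘(ℝ, F) f (φ.symm y) ξ := by
  have hφd : φ.MDifferentiable 𝓘(ℝ, E) 𝓘(ℝ, E) :=
    ⟨fun x hx => (mdifferentiableAt_of_mem_maximalAtlas hφ hx).mdifferentiableWithinAt,
      fun x hx => (mdifferentiableAt_symm_of_mem_maximalAtlas hφ hx).mdifferentiableWithinAt⟩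
  obtain ⟨h, rfl⟩ := hφd.symm.mfderiv_surjective hy ξ
  refine ⟨h, ?_⟩
  rw [← mfderiv_eq_fderiv]
  exact congrArg (fun B => B h) (mfderiv_comp y hf (hφd.mdifferentiableAt_symm hy))

theorem surjective_traceFreeEntries_comp_fderiv_resolvent {g : X → H →L[ℝ] H →L[ℝ] ℝ}
    {A : X → H →ₗ.[ℝ] H} (hφ : φ ∈ IsManifold.maximalAtlas 𝓘(ℝ, E) 1 X) {y : E}
    (hy : y ∈ φ.target) {μ : ℝ} (hdiff : MDifferentiableAt 𝓘(ℝ, E) 𝓘(ℝ, H →L[ℝ] H)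
      (fun p => resolvent (A p) μ) (φ.symm y)) {v₁ v₂ : H}
    (hind : LinearIndependent ℝ
      ![derivEntry E g A μ (φ.symm y) v₁ v₁ - derivEntry E g A μ (φ.symm y) v₂ v₂,
        derivEntry E g A μ (φ.symm y) v₁ v₂]) :
    Function.Surjective (traceFreeEntries (g (φ.symm y)) v₁ v₂ ∘L
      fderiv ℝ (fun y' => resolvent (A (φ.symm y')) μ) y) := by
  intro z
  obtain ⟨ξ, rfl⟩ := surjective_pi_of_linearIndependent hind z
  obtain ⟨h, hh⟩ := exists_fderiv_comp_symm_eq hφ hy hdiff ξ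
  refine ⟨h, (congrArg (traceFreeEntries (g (φ.symm y)) v₁ v₂) hh).trans ?_⟩
  ext i
  fin_cases i <;> rfl

theorem SAH2.exists_hasTangentCodim [CompleteSpace H] {g : X → H →L[ℝ] H →L[ℝ] ℝ}
    {A : X → H →ₗ.[ℝ] H} (hsah : SAH2 E g A) (hg : ∀ q, IsEquivInner (g q))
    (hA : ∀ q, IsSelfAdjointFor (g q) (A q)) (hspec : ∀ q, HasDiscreteSpectrum (A q))
    (hres : ResolventsDifferentiable E A) (hφ : φ ∈ IsManifold.maximalAtlas 𝓘(ℝ, E) 1 X) {y : E}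
    (hy : y ∈ φ.target) {l : ℝ} (hl : 2 ≤ Module.rank ℝ (eigenspace (A (φ.symm y)) l)) :
    ∃ I ∈ 𝓝 l, HasTangentCodim (multiplicityStratum (fun y' => A (φ.symm y'))
      (finrank ℝ (eigenspace (A (φ.symm y)) l)) I) y 2 := by
  obtain ⟨μ, hμ, v₁, hv₁, v₂, hv₂, h₁₁, h₂₂, h₁₂, hind⟩ := hsah (φ.symm y) l hl
  obtain ⟨hev, hdiff⟩ := hres (φ.symm y) μ hμ
  exact exists_hasTangentCodim_multiplicityStratum (A := fun y' => A (φ.symm y')) (hg _) (hA _)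
    (hspec _) ((φ.continuousAt_symm hy).eventually hev)
    (hdiff.comp y (mdifferentiableAt_symm_of_mem_maximalAtlas hφ hy)).differentiableAt
    hv₁ hv₂ h₁₁ h₂₂ h₁₂ (surjective_traceFreeEntries_comp_fderiv_resolvent hφ hy hdiff hind)

end Family

end MeagreCodim

end

theorem mainTheorem4_general
    {E : Type*} [NormedAddCommGroup E] [NormedSpace ℝ E] [CompleteSpace E]
    {X : Type*} [TopologicalSpace X] [ChartedSpace E X] [TopologicalSpace.SeparableSpace X]
    (k : WithTop ℕ∞) (hk : 1 ≤ k)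
    {H : Type*} [NormedAddCommGroup H] [NormedSpace ℝ H] [CompleteSpace H]
    (g : X → H →L[ℝ] H →L[ℝ] ℝ)
    (hg_inner : ∀ q, MeagreCodim.IsEquivInner (g q))
    (A : X → H →ₗ.[ℝ] H)
    (hA_selfAdjoint : ∀ q, MeagreCodim.IsSelfAdjointFor (g q) (A q))
    (hA_spectrum : ∀ q, MeagreCodim.HasDiscreteSpectrum (A q))
    (hA_resolvent : MeagreCodim.ResolventsDifferentiable E A)
    (hA_SAH2 : MeagreCodim.SAH2 E g A) :
    MeagreCodim.HasMeagreCodim E k {q : X | MeagreCodim.HasRepeatedEigenvalue (A q)} 2 := by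
  intro φ hφ
  have hφ₁ := IsManifold.maximalAtlas_subset_of_le hk hφ
  rw [φ.image_source_inter_eq']
  rcases φ.target.eq_empty_or_nonempty with hempty | hne
  · intro m _ Z π _
    rw [hempty, empty_inter, image_empty]
    exact IsMeagre.empty
  have := MeagreCodim.separableSpace_of_chart φ hne
  have hbasis := TopologicalSpace.isBasis_countableBasis ℝ
  refine MeagreCodim.hasMeagreCodimIn_of_hasTangentCodim
    (fun i : ℕ × TopologicalSpace.countableBasis ℝ =>
      MeagreCodim.multiplicityStratum (fun y => A (φ.symm y)) i.1 i.2) inter_subset_left ?_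
  rintro y ⟨hy, l, hl⟩
  obtain ⟨I, hI, htangent⟩ :=
    hA_SAH2.exists_hasTangentCodim hg_inner hA_selfAdjoint hA_spectrum hA_resolvent hφ₁ hy hl
  obtain ⟨V, hV, hlV, hVI⟩ := hbasis.mem_nhds_iff.1 hI
  exact ⟨(_, ⟨V, hV⟩), ⟨l, hlV, rfl⟩,
    htangent.mono (MeagreCodim.multiplicityStratum_mono _ _ hVI)⟩

theorem mainTheorem4
    {E : Type*} [NormedAddCommGroup E] [NormedSpace ℝ E] [CompleteSpace E]
    {X : Type*} [TopologicalSpace X] [ChartedSpace E X] [TopologicalSpace.SeparableSpace X]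
    (k : WithTop ℕ∞) (hk : 1 ≤ k) [IsManifold 𝓘(ℝ, E) k X]
    {H : Type*} [NormedAddCommGroup H] [NormedSpace ℝ H] [CompleteSpace H]
    (g : X → H →L[ℝ] H →L[ℝ] ℝ)
    (hg_inner : ∀ q, MeagreCodim.IsEquivInner (g q))
    (hg_diff : MDifferentiable 𝓘(ℝ, E) 𝓘(ℝ, H →L[ℝ] H →L[ℝ] ℝ) g)
    (A : X → H →ₗ.[ℝ] H)
    (hA_domain : ∀ p q, (A p).domain = (A q).domain)
    (hA_selfAdjoint : ∀ q, MeagreCodim.IsSelfAdjointFor (g q) (A q))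
    (hA_spectrum : ∀ q, MeagreCodim.HasDiscreteSpectrum (A q))
    (hA_resolvent : MeagreCodim.ResolventsDifferentiable E A)
    (hA_SAH2 : MeagreCodim.SAH2 E g A) :
    MeagreCodim.HasMeagreCodim E k {q : X | MeagreCodim.HasRepeatedEigenvalue (A q)} 2 :=
  mainTheorem4_general k hk g hg_inner A hA_selfAdjoint hA_spectrum hA_resolvent hA_SAH2
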